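/- For every integer $N\ge 1$ let $$\mathfrak{E}_N := \left\{\sum_{n=1}^N \frac{t_n}{n} : t_1,\dots,t_N\in\{0,1\}\right\}\subset\mathbb{Q},$$ and let $$\alpha := \limsup_{N\to+\infty}\frac{\log(\#\mathfrak{E}_N)}{N},$$ where $\log$ is the natural logarithm and $\#$ denotes the number of elements of a finite set. Then $\alpha<0.421$; in particular, $\log(\#\mathfrak{E}_N)<0.421\,N$ for all sufficiently large $N$. -/

import Mathlib

/-- The set `𝔈_N` of all rational numbers `∑_{n = 1}^N t_n / n` with `t_1, …, t_N ∈ {0, 1}`. -/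
def egyptianFractions (N : ℕ) : Set ℚ :=
  {x | ∃ t : ℕ → ℚ, (∀ n ∈ Finset.Icc 1 N, t n = 0 ∨ t n = 1) ∧
    x = ∑ n ∈ Finset.Icc 1 N, t n / (n : ℚ)}

/-- `𝔈_N` is finite, so that `Set.ncard` below is its true number of elements. -/
theorem egyptianFractions_finite (N : ℕ) : (egyptianFractions N).Finite := by
  refine ((Finset.Icc 1 N).powerset.image
    (fun S : Finset ℕ => ∑ n ∈ S, 1 / (n : ℚ))).finite_toSet.subset ?_
  rintro x ⟨t, ht, rfl⟩
  rw [Finset.mem_coe, Finset.mem_image]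
  refine ⟨(Finset.Icc 1 N).filter (fun n => t n = 1),
    Finset.mem_powerset.2 (Finset.filter_subset _ _), ?_⟩
  rw [Finset.sum_filter]
  refine Finset.sum_congr rfl fun n hn => ?_
  rcases ht n hn with h | h <;> simp [h]

/-- `α = limsup_{N → ∞} log(#𝔈_N) / N`. The sequence is bounded (its values lie in
`[0, log 2]`), so the real `limsup` is the genuine one. -/
noncomputable def egyptianAlpha : ℝ :=
  Filter.limsup (fun N : ℕ => Real.log ((egyptianFractions N).ncard : ℝ) / (N : ℝ)) Filter.atTop

/-! Let `D` be the part of `lcm(1, …, N)` built from primes up to `N / 4`. An `n ≤ N` not dividing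
`D` has a prime factor above `N / 4`, so only `O(π(N)) = o(N)` such `n` exist, and their choices
contribute a factor `2 ^ o(N)`. The other terms sum to a fraction `m / D` with `m ≤ N * D`, so `log
#𝔈_N ≤ log D + o(N)`. Since `ψ - θ = O(√N)` and `θ(x) ≤ x log 4`, `log D ≤ (log 2 / 2) N + o(N)`,
and `log 2 / 2 < 0.35`. Cutting at `N / 3` would give only `log 4 / 3 > 0.46`. -/

/-- The largest divisor of `lcm(1, …, N)` all of whose prime factors are at most `M`. -/
def smoothLcm (M N : ℕ) : ℕ := ∏ p ∈ Nat.primesLE M, p ^ Nat.log p N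

theorem smoothLcm_pos (M N : ℕ) : 0 < smoothLcm M N :=
  Finset.prod_pos fun _ hp => pow_pos (Nat.prime_of_mem_primesLE hp).pos _

/-- Dropping the primes in `(M, N]` from `ψ(N)` removes at least `θ(N) - θ(M)`, as each occurs there
with exponent at least 1. -/
theorem log_smoothLcm_le {M N : ℕ} (hMN : M ≤ N) :
    Real.log (smoothLcm M N) ≤ Chebyshev.psi N - Chebyshev.theta N + Chebyshev.theta M := by
  have hsub : Nat.primesLE M ⊆ Nat.primesLE N := fun p hp => by
    rw [Nat.mem_primesLE] at hp ⊢
    exact ⟨hp.1.trans hMN, hp.2⟩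
  have hlog : Real.log (smoothLcm M N) =
      ∑ p ∈ Nat.primesLE M, (Nat.log p N : ℝ) * Real.log p := by
    rw [smoothLcm, Nat.cast_prod, Real.log_prod]
    · simp
    · intro p hp
      exact_mod_cast (pow_pos (Nat.prime_of_mem_primesLE hp).pos _).ne'
  rw [hlog, Chebyshev.psi_eq_sum_mul_log_prime, Chebyshev.theta_eq_sum_primesLE_log,
    Chebyshev.theta_eq_sum_primesLE_log, ← Finset.sum_sdiff hsub, ← Finset.sum_sdiff hsub]
  have hlarge : ∑ p ∈ Nat.primesLE N \ Nat.primesLE M, Real.log p ≤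
      ∑ p ∈ Nat.primesLE N \ Nat.primesLE M, (Nat.log p N : ℝ) * Real.log p := by
    refine Finset.sum_le_sum fun p hp => ?_
    have hp' := Nat.mem_primesLE.1 (Finset.mem_sdiff.1 hp).1
    refine le_mul_of_one_le_left (Real.log_natCast_nonneg p) ?_
    exact_mod_cast Nat.log_pos hp'.2.one_lt hp'.1
  linarith

theorem dvd_smoothLcm {M N n : ℕ} (hn : n ∈ Finset.Icc 1 N)
    (h : ∀ p, p.Prime → p ∣ n → p ≤ M) : n ∣ smoothLcm M N := by
  obtain ⟨h1, hN⟩ := Finset.mem_Icc.1 hn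
  have hn0 : n ≠ 0 := by omega
  have hsub : n.primeFactors ⊆ Nat.primesLE M := fun p hp =>
    Nat.mem_primesLE.2 ⟨h p (Nat.prime_of_mem_primeFactors hp)
      (Nat.dvd_of_mem_primeFactors hp), Nat.prime_of_mem_primeFactors hp⟩
  calc n = ∏ p ∈ n.primeFactors, p ^ n.factorization p := by
        conv_lhs => rw [← Nat.prod_factorization_pow_eq_self hn0]
        rw [Nat.prod_factorization_eq_prod_primeFactors]
    _ ∣ ∏ p ∈ n.primeFactors, p ^ Nat.log p N :=
        Finset.prod_dvd_prod_of_dvd _ _ fun p hp => pow_dvd_pow p <|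
          Nat.le_log_of_pow_le (Nat.prime_of_mem_primeFactors hp).one_lt
            ((Nat.ordProj_le p hn0).trans hN)
    _ ∣ smoothLcm M N := Finset.prod_dvd_prod_of_subset _ _ _ hsub

/-- Such an `n` is `j * p` with `p > N / 4` prime, which forces `j ≤ 3`. -/
theorem card_not_dvd_smoothLcm_le (N : ℕ) :
    ((Finset.Icc 1 N).filter fun n => ¬ n ∣ smoothLcm (N / 4) N).card ≤
      3 * Nat.primeCounting N := by
  have hsub : ((Finset.Icc 1 N).filter fun n => ¬ n ∣ smoothLcm (N / 4) N) ⊆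
      (Finset.Icc 1 3 ×ˢ Nat.primesLE N).image fun q => q.1 * q.2 := by
    intro n hn
    obtain ⟨hnN, hnd⟩ := Finset.mem_filter.1 hn
    have hp : ∃ p, p.Prime ∧ p ∣ n ∧ N / 4 < p := by
      by_contra! hcon
      exact hnd (dvd_smoothLcm hnN hcon)
    obtain ⟨p, hp, ⟨j, rfl⟩, hlt⟩ := hp
    obtain ⟨h1, hN⟩ := Finset.mem_Icc.1 hnN
    have hj : j ≠ 0 := by rintro rfl; simp at h1
    have hj4 : j < 4 := by
      by_contra! hj4
      have : p * 4 ≤ p * j := Nat.mul_le_mul_left p hj4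
      omega
    refine Finset.mem_image.2 ⟨(j, p), Finset.mem_product.2 ⟨?_, ?_⟩, mul_comm _ _⟩
    · simp only [Finset.mem_Icc]; omega
    · exact Nat.mem_primesLE.2 ⟨(Nat.le_mul_of_pos_right p (by omega)).trans hN, hp⟩
  refine (Finset.card_le_card hsub).trans (Finset.card_image_le.trans ?_)
  rw [Finset.card_product, Nat.primesLE_card_eq_primeCounting]
  simp

theorem sum_div_eq_div_of_dvd {s : Finset ℕ} {D : ℕ} (hD : 0 < D) (hs : ∀ n ∈ s, n ∣ D)
    {t : ℕ → ℚ} (ht : ∀ n ∈ s, t n = 0 ∨ t n = 1) :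
    ∃ m ≤ s.card * D, ∑ n ∈ s, t n / (n : ℚ) = m / D := by
  refine ⟨∑ n ∈ s, if t n = 1 then D / n else 0, ?_, ?_⟩
  · refine Finset.sum_le_card_nsmul _ _ _ fun n _ => ?_
    split_ifs
    exacts [Nat.div_le_self _ _, Nat.zero_le _]
  · rw [Nat.cast_sum, Finset.sum_div]
    refine Finset.sum_congr rfl fun n hn => ?_
    have hD' : (D : ℚ) ≠ 0 := by exact_mod_cast hD.ne'
    have hn0 : (n : ℚ) ≠ 0 := by
      exact_mod_cast (Nat.pos_of_dvd_of_pos (hs n hn) hD).ne'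
    rcases ht n hn with h | h
    · simp [h]
    · rw [h, if_pos rfl, Nat.cast_div (hs n hn) hn0]
      field_simp

/-- A sum is determined by the subset of non-divisors of `D` that it uses and by the numerator over
`D` of the remaining terms. -/
theorem ncard_egyptianFractions_le (N : ℕ) {D : ℕ} (hD : 0 < D) :
    (egyptianFractions N).ncard ≤
      2 ^ ((Finset.Icc 1 N).filter fun n => ¬ n ∣ D).card * (N * D + 1) := by
  set B := (Finset.Icc 1 N).filter fun n => ¬ n ∣ D with hB
  have hsub : egyptianFractions N ⊆
      ((B.powerset ×ˢ Finset.range (N * D + 1)).image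
        fun q : Finset ℕ × ℕ => (q.2 : ℚ) / D + ∑ n ∈ q.1, 1 / (n : ℚ) : Finset ℚ) := by
    rintro x ⟨t, ht, rfl⟩
    obtain ⟨m, hm, hsum⟩ := sum_div_eq_div_of_dvd (s := (Finset.Icc 1 N).filter (· ∣ D)) hD
      (fun n hn => (Finset.mem_filter.1 hn).2) (fun n hn => ht n (Finset.mem_filter.1 hn).1)
    have hcard : ((Finset.Icc 1 N).filter (· ∣ D)).card ≤ N := by
      simpa using Finset.card_filter_le (Finset.Icc 1 N) (· ∣ D)
    refine Finset.mem_coe.2 (Finset.mem_image.2 ⟨(B.filter fun n => t n = 1, m), ?_, ?_⟩)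
    · refine Finset.mem_product.2 ⟨Finset.mem_powerset.2 (Finset.filter_subset _ _), ?_⟩
      exact Finset.mem_range.2 (Nat.lt_succ_of_le (hm.trans (Nat.mul_le_mul_right D hcard)))
    · rw [← Finset.sum_filter_add_sum_filter_not (Finset.Icc 1 N) (· ∣ D), hsum,
        Finset.sum_filter (s := B)]
      congr 1
      refine Finset.sum_congr rfl fun n hn => ?_
      rcases ht n (Finset.mem_filter.1 hn).1 with h | h <;> simp [h]
  calc (egyptianFractions N).ncard ≤ _ := Set.ncard_le_ncard hsub (Finset.finite_toSet _)
    _ ≤ _ := by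
      rw [Set.ncard_coe_finset]
      refine Finset.card_image_le.trans ?_
      rw [Finset.card_product, Finset.card_powerset, Finset.card_range]

theorem ncard_egyptianFractions_pos (N : ℕ) : 0 < (egyptianFractions N).ncard :=
  (Set.ncard_pos (egyptianFractions_finite N)).2 ⟨_, fun _ => 0, fun _ _ => Or.inl rfl, rfl⟩

theorem log_ncard_egyptianFractions_le {N : ℕ} (hN : 1 ≤ N) :
    Real.log (egyptianFractions N).ncard ≤
      3 * Real.log 2 * Nat.primeCounting N + Real.log 2 + Real.log N +
        (Chebyshev.psi N - Chebyshev.theta N) + Real.log 2 / 2 * N := by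
  set D := smoothLcm (N / 4) N with hD
  have hDpos : 0 < D := smoothLcm_pos _ _
  have hcount : (egyptianFractions N).ncard ≤
      2 ^ (3 * Nat.primeCounting N) * (2 * N * D) := by
    refine (ncard_egyptianFractions_le N hDpos).trans (Nat.mul_le_mul ?_ ?_)
    · exact Nat.pow_le_pow_right two_pos (card_not_dvd_smoothLcm_le N)
    · have := Nat.mul_pos hN hDpos
      rw [mul_assoc]
      omega
  have hlogD : Real.log D ≤
      Chebyshev.psi N - Chebyshev.theta N + Real.log 2 / 2 * N := by
    refine (log_smoothLcm_le (Nat.div_le_self N 4)).trans ?_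
    have hθ := Chebyshev.theta_le_log4_mul_x (x := ((N / 4 : ℕ) : ℝ)) (Nat.cast_nonneg _)
    have hdiv : ((N / 4 : ℕ) : ℝ) ≤ N / 4 := by exact_mod_cast Nat.cast_div_le
    have h4 : Real.log 4 = 2 * Real.log 2 := by
      rw [show (4 : ℝ) = 2 ^ 2 by norm_num, Real.log_pow]; norm_num
    have := mul_le_mul_of_nonneg_left hdiv (Real.log_nonneg (by norm_num : (1 : ℝ) ≤ 4))
    rw [h4] at this hθ
    linarith
  have hN' : (N : ℝ) ≠ 0 := by positivity
  have hD' : (D : ℝ) ≠ 0 := by positivity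
  have hlog : Real.log (egyptianFractions N).ncard ≤
      Real.log ((2 : ℝ) ^ (3 * Nat.primeCounting N) * (2 * N * D)) :=
    Real.log_le_log (by exact_mod_cast ncard_egyptianFractions_pos N) (by exact_mod_cast hcount)
  rw [Real.log_mul (by positivity) (by positivity), Real.log_mul (by positivity) hD',
    Real.log_mul (by positivity) hN', Real.log_pow] at hlog
  push_cast at hlog
  linarith

theorem eventually_log_ncard_egyptianFractions_le :
    ∀ᶠ N : ℕ in Filter.atTop, Real.log (egyptianFractions N).ncard ≤ 0.42 * (N : ℝ) := by
  obtain ⟨C, hC⟩ := Chebyshev.psi_sub_theta_le_mul_sqrt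
  have hcast := tendsto_natCast_atTop_atTop (R := ℝ)
  have hπ := hcast.eventually (Chebyshev.eventually_primeCounting_le one_pos)
  -- With `log 4 + 1 ≤ 3`, the threshold 300 gives `π(N) ≤ 3 N / 300 = 0.01 N`.
  have hloglarge := hcast.eventually (Real.tendsto_log_atTop.eventually_ge_atTop 300)
  have hlogsmall := hcast.eventually
    (Real.isLittleO_log_id_atTop.bound (by norm_num : (0 : ℝ) < 0.01))
  have hsqrt := hcast.eventually (Real.tendsto_sqrt_atTop.eventually_ge_atTop (100 * C))
  filter_upwards [hπ, hloglarge, hlogsmall, hsqrt, Filter.eventually_ge_atTop 100]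
    with N hπ hloglarge hlogsmall hsqrt hN
  have hN' : (100 : ℝ) ≤ N := by exact_mod_cast hN
  have hmain := log_ncard_egyptianFractions_le (N := N) (by omega)
  have h2 := Real.log_two_lt_d9
  have h2pos : 0 < Real.log 2 := Real.log_pos one_lt_two
  have hψ : Chebyshev.psi N - Chebyshev.theta N ≤ 0.01 * N := by
    refine (hC N).trans ?_
    have hs := Real.mul_self_sqrt (Nat.cast_nonneg (α := ℝ) N)
    have := mul_le_mul_of_nonneg_right hsqrt (Real.sqrt_nonneg (N : ℝ))
    linarith
  have hlogN : Real.log N ≤ 0.01 * N := by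
    have := (le_abs_self _).trans hlogsmall
    simpa using this
  have hπ' : (Nat.primeCounting N : ℝ) ≤ 0.01 * N := by
    rw [Nat.floor_natCast] at hπ
    refine hπ.trans ?_
    rw [div_le_iff₀ (by linarith)]
    have h4 : Real.log 4 = 2 * Real.log 2 := by
      rw [show (4 : ℝ) = 2 ^ 2 by norm_num, Real.log_pow]; norm_num
    have h3 : Real.log 4 + 1 ≤ 3 := by linarith
    have := mul_le_mul_of_nonneg_right h3 (Nat.cast_nonneg (α := ℝ) N)
    have := mul_le_mul_of_nonneg_left hloglarge (by positivity : (0 : ℝ) ≤ 0.01 * N)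
    linarith
  have hprimes : 3 * Real.log 2 * Nat.primeCounting N ≤ 3 * 0.7 * (0.01 * N) := by
    gcongr
    linarith
  have hlin : Real.log 2 / 2 * N ≤ 0.35 * N := by
    gcongr
    linarith
  -- The total is `(0.021 + 0.01 + 0.01 + 0.35) N + log 2`; the constant is absorbed because `N ≥
  -- 100`.
  linarith

theorem theorem1p2 :
    egyptianAlpha < 0.421 ∧
      ∀ᶠ N : ℕ in Filter.atTop,
        Real.log ((egyptianFractions N).ncard : ℝ) < 0.421 * (N : ℝ) := by
  have hev := eventually_log_ncard_egyptianFractions_le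
  constructor
  · have hle : egyptianAlpha ≤ 0.42 := by
      refine Filter.limsup_le_of_le ?_ ?_
      -- A real `limsup` is bounded above only once the sequence is known not to tend to `-∞`; here
      -- it is nonnegative.
      · refine Filter.isCoboundedUnder_le_of_le Filter.atTop (x := 0) fun N => ?_
        exact div_nonneg (Real.log_natCast_nonneg _) (Nat.cast_nonneg _)
      · filter_upwards [hev, Filter.eventually_gt_atTop 0] with N h hN
        rwa [div_le_iff₀ (by exact_mod_cast hN)]
    exact hle.trans_lt (by norm_num)
  · filter_upwards [hev, Filter.eventually_gt_atTop 0] with N h hN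
    have : (0 : ℝ) < N := by exact_mod_cast hN
    linarith
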